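/- Let $K$ be a field of characteristic $p\ge 3$. A Lie–Rinehart superalgebra $(A,L,\rho)$ over $K$ consists of an associative unital supercommutative $K$-superalgebra $A=A_{\bar 0}\oplus A_{\bar 1}$, a Lie superalgebra $L=L_{\bar 0}\oplus L_{\bar 1}$ over $K$ (with $[x,[x,x]]=0$ for all $x\in L_{\bar 1}$ included in the definition) that is also a graded $A$-module, and an $A$-linear morphism of Lie superalgebras $\rho:L\to\mathrm{Der}(A)$ into the superderivations of $A$ such that $$[x,ay]=(-1)^{|x||a|}a[x,y]+\rho(x)(a)\,y$$ for all homogeneous $x\in L$, $a\in A$ and all $y\in L$. A Lie–Rinehart module $(\phi,M)$ over it is a graded $A$-module $M=M_{\bar 0}\oplus M_{\bar 1}$ with an $A$-linear morphism of Lie superalgebras $\phi:L\to\mathrm{End}_K(M)$ such that $$\phi(x)(am)=(-1)^{|x||a|}a\,\phi(x)(m)+\rho(x)(a)\,m$$ for all homogeneous $x\in L$, $a\in A$ and all $m\in M$. **Theorem 3.1 (Superization of Hochschild's Lemma).** Let $(A,L,\rho)$ be a Lie–Rinehart superalgebra over $K$ and let $(\phi,M)$ be a Lie–Rinehart module over it.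 Then the following identities hold in $\mathrm{End}_K(M)$. 1. For all $a\in A_{\bar 0}$ and $x\in L_{\bar 0}$: $$\phi(ax)^p=a^p\phi(x)^p+\rho(ax)^{p-1}(a)\,\phi(x).$$ 2. For all $a\in A_{\bar 0}$ and $x\in L_{\bar 1}$: $$\phi(ax)^{2p}=a^{2p}\phi(x)^{2p}+\rho(ax)^{2p-1}(a)\,\phi(x)+\sum_{i=0}^{p-1}\lambda_i\,\rho(ax)^i(a)\,\rho(ax)^{2p-2-i}(a)\,\phi(x)^2.$$ 3. For all $a\in A_{\bar 1}$ and $x\in L_{\bar 0}$: $$\phi(ax)^{2p}=0.$$ 4. For all $a\in A_{\bar 1}$ and $x\in L_{\bar 1}$: $$\phi(ax)^p=a\,\bigl(\rho(x)(a)\bigr)^{p-1}\phi(x).$$ Here the coefficients are the images in $K$ of the integers $$\lambda_i=\begin{cases}2(-1)^{i/2}&\text{if } i \text{ is even},\ 0\le i<p-1,\\ 2(-1)^{(i-1)/2}&\text{if } i\text{ is odd},\ 1\le i<p-1,\\ (-1)^{(p-1)/2}&\text{if } i=p-1.\end{cases}$$ -/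

import Mathlib

/-!
Superspaces over a field `K` are `K`-modules with a decomposition indexed by `ZMod 2`
(degree `0` is the even part, degree `1` the odd part).  All conditions involving parities are
imposed on homogeneous elements, as usual.
-/

/-- The Koszul sign `(-1)^{|u||v|}` attached to two parities. -/
def koszulSign (i j : ZMod 2) : ℤ := (-1) ^ (i.val * j.val)

section

variable {K : Type*} [Field K]

/-- `f` is a homogeneous endomorphism of parity `i` of the superspace `V`. -/
def IsHomogeneousEnd {V : Type*} [AddCommGroup V] [Module K V] (𝒱 : ZMod 2 → Submodule K V)
    (i : ZMod 2) (f : Module.End K V) : Prop :=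
  ∀ j : ZMod 2, ∀ v ∈ 𝒱 j, f v ∈ 𝒱 (i + j)

/-- `D` is a homogeneous superderivation of parity `i` of the superalgebra `A`: a homogeneous
`K`-linear map of parity `i` with `D (a b) = D (a) b + (-1)^{|D||a|} a D (b)`. -/
def IsSuperDerivation {A : Type*} [Ring A] [Algebra K A] (𝒜 : ZMod 2 → Submodule K A)
    (i : ZMod 2) (D : Module.End K A) : Prop :=
  IsHomogeneousEnd 𝒜 i D ∧
    ∀ j : ZMod 2, ∀ a ∈ 𝒜 j, ∀ b : A, D (a * b) = D a * b + koszulSign i j • (a * D b)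

/-- A superalgebra is supercommutative if `a b = (-1)^{|a||b|} b a`. -/
def IsSupercommutative {A : Type*} [Ring A] [Algebra K A] (𝒜 : ZMod 2 → Submodule K A) : Prop :=
  ∀ i j : ZMod 2, ∀ a ∈ 𝒜 i, ∀ b ∈ 𝒜 j, a * b = koszulSign i j • (b * a)

/-- A Lie superalgebra structure on the superspace `L`.  The last condition follows from the
Jacobi identity unless the characteristic is `3`, where it is part of the definition. -/
structure LieSuperalgebra {L : Type*} [AddCommGroup L] [Module K L]
    (𝓛 : ZMod 2 → Submodule K L) where
  /-- The bracket `[x, y]`. -/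
  bracket : L →ₗ[K] L →ₗ[K] L
  bracket_mem : ∀ i j : ZMod 2, ∀ x ∈ 𝓛 i, ∀ y ∈ 𝓛 j, bracket x y ∈ 𝓛 (i + j)
  bracket_skew : ∀ i j : ZMod 2, ∀ x ∈ 𝓛 i, ∀ y ∈ 𝓛 j,
    bracket x y = -(koszulSign i j • bracket y x)
  jacobi : ∀ i j k : ZMod 2, ∀ x ∈ 𝓛 i, ∀ y ∈ 𝓛 j, ∀ z ∈ 𝓛 k,
    bracket x (bracket y z) =
      bracket (bracket x y) z + koszulSign i j • bracket y (bracket x z)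
  bracket_odd_cube : ∀ x ∈ 𝓛 1, bracket x (bracket x x) = 0

/-- A Lie-Rinehart superalgebra structure `(A, L, ρ)` on a superalgebra `A` and a graded
`A`-module `L`: `A` is supercommutative, `L` is a Lie superalgebra, and the anchor
`ρ : L → Der(A)` is an `A`-linear morphism of Lie superalgebras satisfying the Leibniz
condition `[x, a y] = (-1)^{|x||a|} a [x, y] + ρ(x)(a) y`. -/
structure LieRinehartSuperalgebra {A : Type*} [Ring A] [Algebra K A]
    (𝒜 : ZMod 2 → Submodule K A) {L : Type*} [AddCommGroup L] [Module K L] [Module A L]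
    [IsScalarTower K A L] (𝓛 : ZMod 2 → Submodule K L) extends LieSuperalgebra 𝓛 where
  supercomm : IsSupercommutative 𝒜
  /-- The anchor `ρ`. -/
  anchor : L →ₗ[K] Module.End K A
  anchor_superDerivation : ∀ i : ZMod 2, ∀ x ∈ 𝓛 i, IsSuperDerivation 𝒜 i (anchor x)
  anchor_bracket : ∀ i j : ZMod 2, ∀ x ∈ 𝓛 i, ∀ y ∈ 𝓛 j,
    anchor (bracket x y) = anchor x * anchor y - koszulSign i j • (anchor y * anchor x)
  anchor_smul : ∀ (a : A) (x : L), anchor (a • x) = a • anchor x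
  leibniz : ∀ i j : ZMod 2, ∀ x ∈ 𝓛 i, ∀ a ∈ 𝒜 j, ∀ y : L,
    bracket x (a • y) = koszulSign i j • (a • bracket x y) + anchor x a • y

/-- A Lie-Rinehart module `(φ, M)` over `(A, L, ρ)`, with `M` a graded `A`-module: an
`A`-linear morphism of Lie superalgebras `φ : L → End(M)` satisfying
`φ(x)(a m) = (-1)^{|x||a|} a φ(x)(m) + ρ(x)(a) m`. -/
structure LieRinehartModule {A : Type*} [Ring A] [Algebra K A]
    {𝒜 : ZMod 2 → Submodule K A} {L : Type*} [AddCommGroup L] [Module K L] [Module A L]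
    [IsScalarTower K A L] {𝓛 : ZMod 2 → Submodule K L} (R : LieRinehartSuperalgebra 𝒜 𝓛)
    {M : Type*} [AddCommGroup M] [Module K M] [Module A M] [IsScalarTower K A M]
    (ℳ : ZMod 2 → Submodule K M) where
  /-- The action `φ`. -/
  act : L →ₗ[K] Module.End K M
  act_homogeneous : ∀ i : ZMod 2, ∀ x ∈ 𝓛 i, IsHomogeneousEnd ℳ i (act x)
  act_bracket : ∀ i j : ZMod 2, ∀ x ∈ 𝓛 i, ∀ y ∈ 𝓛 j,
    act (R.bracket x y) = act x * act y - koszulSign i j • (act y * act x)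
  act_smul : ∀ (a : A) (x : L), act (a • x) = a • act x
  act_leibniz : ∀ i j : ZMod 2, ∀ x ∈ 𝓛 i, ∀ a ∈ 𝒜 j, ∀ m : M,
    act x (a • m) = koszulSign i j • (a • act x m) + R.anchor x a • m

end

/-- The integers `λ_i`, for `0 ≤ i ≤ p - 1`. -/
def hochschildCoeff (p i : ℕ) : ℤ :=
  if i = p - 1 then (-1) ^ ((p - 1) / 2)
  else if Even i then 2 * (-1) ^ (i / 2)
  else 2 * (-1) ^ ((i - 1) / 2)

/-!
Write `T = φ(x)` and `D = ρ(x)`, so that `T f = σ f * T + D f` on the module, where `σ` is the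
identity for even `x` and the parity involution of `A` for odd `x`.

For odd `a` everything follows from `a ^ 2 = 0`: one has `(a T) ^ 2 = a (D a) T`.  If `x` is even,
then `D a` is odd and already `(a T) ^ 3 = 0` (`smul_pow_three_eq_zero`); if `x` is odd, then `D a`
is even and `(a T) ^ (n + 1) = a (D a) ^ n T` (`smul_pow_succ_of_odd_of_odd`).

For even `a` the power `(a T) ^ n` has a normally ordered form `∑ k, c n k * T ^ k`, whose
coefficients `powCoeff` do not depend on the module: they arise by iterating on sequences `ℕ → A`
the operator `Λ = leftMulStep` of left multiplication by `a T`.  Most of them vanish for `n = p`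
(respectively `n = 2 p`), because in characteristic `p` the commutator with `Y ^ p` is the `p`-th
power of the commutator with `Y` (`pow_char_commutator_mem`):

* for even `x`, formal differentiation `∂ / ∂T` satisfies `[∂ / ∂T, Λ] = a`, and multiplications by
  `A` are stable under `[Λ, ·]`; so `[∂ / ∂T, Λ ^ p]` is a multiplication and the derivative of
  the normally ordered form of `(a T) ^ p` is constant (`powCoeff_prime_eq_zero`);
* for odd `x`, let `Y = Λ ^ 2`, let `∇ = ∂ / ∂(T ^ 2)` and let `∂` be the odd derivation with
  `T ↦ 1`.  Then `[∇, Λ] = a ∂` and `∂ Λ + Λ ∂ = a`, and the operators `f + g ∂` are stable under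
  `[Y, ·]`; so `∇` maps the normally ordered form of `(a T) ^ (2 p)` to a constant
  (`powCoeff_two_mul_prime_eq_zero`).

The coefficient of the leading term is a power of `a` and that of `T` is `(a D) ^ (n - 1) a`.  With
`a_i = (a D) ^ i a`, the coefficient of `T ^ 2` in `(a T) ^ (2 p)` is a combination of the products
`a_i * a_(2 p - 2 - i)` whose coefficients are binomials `(p - 1).choose j ≡ ± 1`
(`powCoeff_even_two`), and the symmetry `i ↔ 2 p - 2 - i` folds it into the sum with coefficients
`hochschildCoeff` (`sum_hochschildCoeff`).
-/

/-! ### Commutators with `p`-th powers -/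

section Commutator

variable {K : Type*} [Field K] {S : Type*} [Ring S] [Algebra K S]

theorem sub_pow_char_of_commute_of_algebra {p : ℕ} (hp : p.Prime) [CharP K p] {u v : S}
    (h : Commute u v) : (u - v) ^ p = u ^ p - v ^ p := by
  rcases subsingleton_or_nontrivial S with hS | hS
  · exact Subsingleton.elim _ _
  · have := charP_of_injective_algebraMap (algebraMap K S).injective p
    have := Fact.mk hp
    exact sub_pow_char_of_commute p h

/-- In characteristic `p` the `p`-th power of the commutation operator `[Y, ·]` is `[Y ^ p, ·]`;
so an additive subgroup that contains `[Y, Z]` and is stable under `[Y, ·]` contains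
`[Y ^ p, Z]`. -/
theorem pow_char_commutator_mem {p : ℕ} (hp : p.Prime) [CharP K p] (P : AddSubgroup S)
    {Y Z : S} (hZ : Y * Z - Z * Y ∈ P) (hP : ∀ X ∈ P, Y * X - X * Y ∈ P) :
    Y ^ p * Z - Z * Y ^ p ∈ P := by
  have hcomm : Commute (LinearMap.mulLeft K Y) (LinearMap.mulRight K Y) :=
    LinearMap.commute_mulLeft_right Y Y
  have key : ∀ n : ℕ,
      ((LinearMap.mulLeft K Y - LinearMap.mulRight K Y) ^ (n + 1)) Z ∈ P := by
    intro n
    induction n with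
    | zero => simpa using hZ
    | succ n ih =>
      rw [pow_succ']
      simpa using hP _ ih
  have h := key (p - 1)
  rw [Nat.sub_add_cancel hp.one_le, sub_pow_char_of_commute_of_algebra (K := K) hp hcomm,
    LinearMap.pow_mulLeft, LinearMap.pow_mulRight] at h
  simpa using h

end Commutator

/-! ### Normal ordering of powers of `a T` -/

section NormalOrdering

variable {K : Type*} [Field K] {A : Type*} [Ring A] [Algebra K A]

/-- Left multiplication by `a T` on formal expressions `∑ k, c k * T ^ k`, where the symbol `T`
obeys the rule `T f = σ f * T + D f`.  An expression is encoded by its sequence of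
coefficients `c : ℕ → A`. -/
def leftMulStep (a : A) (σ D : Module.End K A) : Module.End K (ℕ → A) where
  toFun c k := a * (D (c k) + Nat.casesOn k 0 fun j => σ (c j))
  map_add' c d := by
    ext k
    cases k <;> simp [mul_add]
    abel
  map_smul' r c := by
    ext k
    cases k <;> simp [mul_add]

variable (a : A) (σ D : Module.End K A)

@[simp] theorem leftMulStep_apply_zero (c : ℕ → A) :
    leftMulStep a σ D c 0 = a * D (c 0) := by simp [leftMulStep]

@[simp] theorem leftMulStep_apply_succ (c : ℕ → A) (k : ℕ) :
    leftMulStep a σ D c (k + 1) = a * D (c (k + 1)) + a * σ (c k) := by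
  simp [leftMulStep, mul_add]

/-- The coefficient of `T ^ k` in the normally ordered form of `(a T) ^ n`. -/
def powCoeff (n : ℕ) : ℕ → A := (leftMulStep a σ D ^ n) (Pi.single 0 1)

theorem powCoeff_zero : powCoeff a σ D 0 = Pi.single 0 1 := by simp [powCoeff]

theorem powCoeff_succ (n : ℕ) :
    powCoeff a σ D (n + 1) = leftMulStep a σ D (powCoeff a σ D n) := by
  simp [powCoeff, pow_succ']

variable {a σ D}

theorem powCoeff_eq_zero_of_lt {n k : ℕ} (h : n < k) : powCoeff a σ D n k = 0 := by
  induction n generalizing k with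
  | zero => simp [powCoeff_zero, h.ne']
  | succ n ih =>
    obtain ⟨j, rfl⟩ : ∃ j, k = j + 1 := ⟨k - 1, by omega⟩
    simp [powCoeff_succ, ih (show n < j + 1 by omega), ih (show n < j by omega)]

/-- The rule `T f = σ f * T + D f` yields the normally ordered form of `(a T) ^ n`. -/
theorem smul_pow_eq_sum_powCoeff {M : Type*} [AddCommGroup M] [Module K M] [Module A M]
    [IsScalarTower K A M] {T : Module.End K M}
    (hT : ∀ (f : A) (m : M), T (f • m) = σ f • T m + D f • m) (n : ℕ) :
    (a • T) ^ n = ∑ k ∈ Finset.range (n + 1), powCoeff a σ D n k • T ^ k := by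
  induction n with
  | zero => simp [powCoeff_zero]
  | succ n ih =>
    have hD : ∑ k ∈ Finset.range (n + 1), (a * D (powCoeff a σ D n k)) • T ^ k
        = ∑ k ∈ Finset.range (n + 1 + 1), (a * D (powCoeff a σ D n k)) • T ^ k := by
      rw [Finset.sum_range_succ _ (n + 1), powCoeff_eq_zero_of_lt (Nat.lt_succ_self n)]
      simp
    have step : ∀ f : A, ∀ k : ℕ,
        (a • T) * (f • T ^ k) = (a * D f) • T ^ k + (a * σ f) • T ^ (k + 1) := by
      intro f k
      ext m
      simp [hT, pow_succ', mul_smul, add_comm]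
    rw [pow_succ', ih, Finset.mul_sum]
    simp_rw [step]
    rw [Finset.sum_add_distrib, hD, Finset.sum_range_succ', Finset.sum_range_succ' _ (n + 1)]
    simp only [powCoeff_succ, leftMulStep_apply_succ, leftMulStep_apply_zero, add_smul,
      Finset.sum_add_distrib]
    abel

theorem powCoeff_succ_zero (hD : D 1 = 0) (n : ℕ) : powCoeff a σ D (n + 1) 0 = 0 := by
  induction n with
  | zero => simp [powCoeff_succ, powCoeff_zero, hD]
  | succ n ih => rw [powCoeff_succ, leftMulStep_apply_zero, ih]; simp

theorem powCoeff_succ_one (hσ : σ 1 = 1) (hD : D 1 = 0) (n : ℕ) :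
    powCoeff a σ D (n + 1) 1 = ((a • D) ^ n) a := by
  induction n with
  | zero => simp [powCoeff_succ, powCoeff_zero, hσ]
  | succ n ih =>
    rw [powCoeff_succ, leftMulStep_apply_succ, ih, powCoeff_succ_zero hD, pow_succ']
    simp

theorem powCoeff_self (hσ : ∀ f g, σ (f * g) = σ f * σ g) (hσ1 : σ 1 = 1) (ha : σ a = a)
    (n : ℕ) : powCoeff a σ D n n = a ^ n := by
  have hpow : ∀ n : ℕ, σ (a ^ n) = a ^ n := by
    intro n
    induction n with
    | zero => simpa using hσ1
    | succ n ih => rw [pow_succ, hσ, ih, ha]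
  induction n with
  | zero => simp [powCoeff_zero]
  | succ n ih =>
    rw [powCoeff_succ, leftMulStep_apply_succ, ih, powCoeff_eq_zero_of_lt (Nat.lt_succ_self n),
      hpow, pow_succ']
    simp

/-- Left multiplication by `a T` is a `σ`-twisted derivation over `a • D`. -/
theorem leftMulStep_mul_smul (hσ : ∀ f g, σ (f * g) = σ f * σ g)
    (hD : ∀ f g, D (f * g) = D f * g + σ f * D g) (ha : ∀ f, a * f = f * a)
    (f : A) (Z : Module.End K (ℕ → A)) :
    leftMulStep a σ D * (f • Z) = (a • D) f • Z + σ f • (leftMulStep a σ D * Z) := by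
  have h : ∀ x y : A, a * (σ x * y) = σ x * (a * y) := fun x y => by
    rw [← mul_assoc, ha, mul_assoc]
  ext c k : 2
  cases k <;> simp [hσ, hD, mul_add, h, mul_assoc]
  abel

end NormalOrdering

/-! ### The coefficients of `(a T) ^ p` for an even operator `T` -/

section EvenOperator

variable {K : Type*} [Field K] {A : Type*} [Ring A] [Algebra K A]

theorem eq_zero_of_nsmul_eq_zero_of_lt_char {p : ℕ} [CharP K p] {V : Type*} [AddCommGroup V]
    [Module K V] {n : ℕ} (hn : 0 < n) (hnp : n < p) {v : V} (h : n • v = 0) : v = 0 := by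
  rw [← Nat.cast_smul_eq_nsmul K, smul_eq_zero] at h
  refine h.resolve_left fun h0 => ?_
  exact absurd (Nat.le_of_dvd hn ((CharP.cast_eq_zero_iff K p n).1 h0)) (by omega)

theorem neg_smul_end (f : A) (Z : Module.End K (ℕ → A)) : (-f) • Z = -(f • Z) :=
  neg_smul f Z

variable (K A) in
/-- Formal differentiation `∂ / ∂T` of coefficient sequences. -/
def coeffDeriv : Module.End K (ℕ → A) where
  toFun c k := (k + 1) • c (k + 1)
  map_add' c d := by ext k; simp
  map_smul' r c := by
    ext k
    simp only [Pi.smul_apply, RingHom.id_apply]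
    rw [smul_comm]

@[simp] theorem coeffDeriv_apply (c : ℕ → A) (k : ℕ) :
    coeffDeriv K A c k = (k + 1) • c (k + 1) := rfl

variable {a : A} {D : Module.End K A}

theorem coeffDeriv_mul_leftMulStep :
    coeffDeriv K A * leftMulStep a 1 D = leftMulStep a 1 D * coeffDeriv K A + a • 1 := by
  ext c k : 2
  cases k <;> simp [-nsmul_eq_mul, add_smul, mul_add]
  abel

/-- The commutator `[(a T) ^ p, ∂ / ∂T]` is multiplication by an element of `A`, so that only `T`
and `T ^ p` contribute to `(a T) ^ p`. -/
theorem powCoeff_prime_eq_zero {p : ℕ} (hp : p.Prime) [CharP K p]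
    (hD : ∀ f g, D (f * g) = D f * g + f * D g) (ha : ∀ f, a * f = f * a)
    {k : ℕ} (hk : 1 < k) (hkp : k < p) : powCoeff a 1 D p k = 0 := by
  set Y := leftMulStep a 1 D with hY
  have hcomm := coeffDeriv_mul_leftMulStep (a := a) (D := D)
  obtain ⟨f, hf⟩ := pow_char_commutator_mem (K := K) hp (Y := Y) (Z := coeffDeriv K A)
    ((smulAddHom A (Module.End K (ℕ → A))).flip 1).range
    ⟨-a, by simp [hY, hcomm]⟩ (by
      rintro _ ⟨f, rfl⟩
      refine ⟨(a • D) f, ?_⟩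
      have := leftMulStep_mul_smul (a := a) (σ := 1) (D := D) (by simp) (by simpa using hD) ha f 1
      simp only [AddMonoidHom.flip_apply, smulAddHom_apply]
      rw [← hY] at this
      rw [this]
      simp)
  -- Both sides are applied to the sequence of the constant `1`, which `∂ / ∂T` annihilates.
  obtain ⟨j, rfl⟩ : ∃ j, k = j + 2 := ⟨k - 2, by omega⟩
  have h0 : coeffDeriv K A (Pi.single 0 (1 : A)) = 0 := by ext i; simp
  have := congrFun (LinearMap.congr_fun hf (Pi.single 0 1)) (j + 1)
  simp only [Y, LinearMap.sub_apply, Module.End.mul_apply, h0] at this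
  simp [-nsmul_eq_mul] at this
  exact eq_zero_of_nsmul_eq_zero_of_lt_char (K := K) (by omega : 0 < j + 2) hkp
    (by simpa [-nsmul_eq_mul, powCoeff] using this)

/-- Hochschild's lemma for an operator `T` with the untwisted Leibniz rule and a central `a`. -/
theorem smul_pow_char_of_leibniz {p : ℕ} (hp : p.Prime) [CharP K p] {M : Type*} [AddCommGroup M]
    [Module K M] [Module A M] [IsScalarTower K A M] {T : Module.End K M}
    (hD : ∀ f g, D (f * g) = D f * g + f * D g) (ha : ∀ f, a * f = f * a)
    (hT : ∀ (f : A) (m : M), T (f • m) = f • T m + D f • m) :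
    (a • T) ^ p = a ^ p • T ^ p + ((a • D) ^ (p - 1)) a • T := by
  have hD1 : D 1 = 0 := by simpa using hD 1 1
  obtain ⟨q, rfl⟩ : ∃ q, p = q + 2 := ⟨p - 2, by have := hp.two_le; omega⟩
  rw [smul_pow_eq_sum_powCoeff (σ := 1) (D := D) (by simpa using hT), Finset.sum_range_succ,
    powCoeff_self (by simp) (by simp) (by simp),
    Finset.sum_eq_single_of_mem 1 (by simp), powCoeff_succ_one (by simp) hD1]
  · rw [pow_one, add_comm]; rfl
  · intro k hk hk1
    rw [Finset.mem_range] at hk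
    rcases Nat.eq_zero_or_pos k with rfl | hk0
    · rw [powCoeff_succ_zero hD1, zero_smul]
    · rw [powCoeff_prime_eq_zero hp hD ha (by omega) hk, zero_smul]

end EvenOperator

/-! ### The coefficients of `(a T) ^ (2 p)` for an odd operator `T` -/

section OddOperator

variable {K : Type*} [Field K] {A : Type*} [Ring A] [Algebra K A]

/-- The odd formal derivation of coefficient sequences with `T ↦ 1` (and hence `T ^ 2 ↦ 0`). -/
def oddCoeffDeriv (σ : Module.End K A) : Module.End K (ℕ → A) where
  toFun c k := if Even k then σ (c (k + 1)) else 0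
  map_add' c d := by ext k; by_cases h : Even k <;> simp [h]
  map_smul' r c := by ext k; by_cases h : Even k <;> simp [h]

variable (K A) in
/-- Formal differentiation `∂ / ∂(T ^ 2)` of coefficient sequences, where `A` and `T` are
constants. -/
def sqCoeffDeriv : Module.End K (ℕ → A) where
  toFun c k := (k / 2 + 1) • c (k + 2)
  map_add' c d := by ext k; simp
  map_smul' r c := by
    ext k
    simp only [Pi.smul_apply, RingHom.id_apply]
    rw [smul_comm]

theorem oddCoeffDeriv_apply (σ : Module.End K A) (c : ℕ → A) (k : ℕ) :
    oddCoeffDeriv σ c k = if Even k then σ (c (k + 1)) else 0 := rfl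

theorem sqCoeffDeriv_apply (c : ℕ → A) (k : ℕ) :
    sqCoeffDeriv K A c k = (k / 2 + 1) • c (k + 2) := rfl

variable {a : A} {σ D : Module.End K A}

theorem oddCoeffDeriv_mul_leftMulStep (hσ : ∀ f g, σ (f * g) = σ f * σ g)
    (hσσ : ∀ f, σ (σ f) = f) (hσD : ∀ f, σ (D f) = -D (σ f)) (ha : σ a = a) :
    oddCoeffDeriv σ * leftMulStep a σ D + leftMulStep a σ D * oddCoeffDeriv σ = a • 1 := by
  ext c k : 2
  cases k with
  | zero => simp [oddCoeffDeriv_apply, hσ, hσσ, hσD, ha]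
  | succ k =>
    by_cases h : Even k <;>
      simp [oddCoeffDeriv_apply, hσ, hσσ, hσD, ha, h, Nat.even_add_one]

theorem sqCoeffDeriv_mul_leftMulStep :
    sqCoeffDeriv K A * leftMulStep a σ D =
      leftMulStep a σ D * sqCoeffDeriv K A + a • oddCoeffDeriv σ := by
  ext c k : 2
  cases k with
  | zero => simp [oddCoeffDeriv_apply, sqCoeffDeriv_apply]
  | succ k =>
    have h3 : leftMulStep a σ D c (k + 1 + 2)
      = a * D (c (k + 1 + 2)) + a * σ (c (k + 2)) := leftMulStep_apply_succ ..
    rcases Nat.even_or_odd k with h | h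
    · have h2 : (k + 1) / 2 = k / 2 := by obtain ⟨r, rfl⟩ := h; omega
      have h1 : ¬ Even (k + 1) := by simpa [Nat.even_add_one] using h
      simp [oddCoeffDeriv_apply, sqCoeffDeriv_apply, h1, h2, h3, -nsmul_eq_mul]
    · have h2 : (k + 1) / 2 = k / 2 + 1 := by obtain ⟨r, rfl⟩ := h; omega
      have h1 : Even (k + 1) := by simpa [Nat.even_add_one] using h
      simp [oddCoeffDeriv_apply, sqCoeffDeriv_apply, h1, h2, h3, -nsmul_eq_mul, add_smul, mul_add]
      abel

/-- For an odd `T` the operator `(a T) ^ 2` commutes with multiplication by `A` up to the even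
derivation `(a D) ^ 2`. -/
theorem leftMulStep_sq_mul_smul (hσ : ∀ f g, σ (f * g) = σ f * σ g)
    (hσσ : ∀ f, σ (σ f) = f) (hσD : ∀ f, σ (D f) = -D (σ f)) (hσa : σ a = a)
    (hD : ∀ f g, D (f * g) = D f * g + σ f * D g) (ha : ∀ f, a * f = f * a)
    (f : A) (Z : Module.End K (ℕ → A)) :
    leftMulStep a σ D ^ 2 * (f • Z) =
      ((a • D) ^ 2) f • Z + f • (leftMulStep a σ D ^ 2 * Z) := by
  have h := leftMulStep_mul_smul (K := K) hσ hD ha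
  have h1 : σ ((a • D) f) = -(a • D) (σ f) := by simp [hσ, hσD, hσa]
  rw [pow_two, mul_assoc, h, mul_add, h, h, h1, hσσ, pow_two, mul_assoc]
  simp only [neg_smul_end, Module.End.mul_apply]
  abel

/-- The operators `f + g ∂`, with `f, g` in `A` and `∂` the odd formal derivation, form a subgroup
that contains `[(a T) ^ 2, ∂ / ∂(T ^ 2)]` and is stable under `[(a T) ^ 2, ·]`.  Hence it contains
`[(a T) ^ (2 p), ∂ / ∂(T ^ 2)]`, so that only `T`, `T ^ 2` and `T ^ (2 p)` contribute to
`(a T) ^ (2 p)`. -/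
theorem powCoeff_two_mul_prime_eq_zero {p : ℕ} (hp : p.Prime) [CharP K p]
    (hσ : ∀ f g, σ (f * g) = σ f * σ g) (hσσ : ∀ f, σ (σ f) = f) (hσD : ∀ f, σ (D f) = -D (σ f))
    (hσa : σ a = a) (hD : ∀ f g, D (f * g) = D f * g + σ f * D g) (ha : ∀ f, a * f = f * a)
    {k : ℕ} (hk : 2 < k) (hkp : k < 2 * p) : powCoeff a σ D (2 * p) k = 0 := by
  set Λ := leftMulStep a σ D with hΛ
  set d := oddCoeffDeriv σ with hd
  set e := sqCoeffDeriv K A with he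
  have hdΛ : d * Λ = a • 1 - Λ * d :=
    eq_sub_of_add_eq (oddCoeffDeriv_mul_leftMulStep hσ hσσ hσD hσa)
  have heΛ : e * Λ = Λ * e + a • d := sqCoeffDeriv_mul_leftMulStep
  have hsm : ∀ Z, Λ * (a • Z) = (a • D) a • Z + a • (Λ * Z) := fun Z => by
    have := leftMulStep_mul_smul (K := K) hσ hD ha a Z
    rwa [hσa] at this
  have hsq := leftMulStep_sq_mul_smul (K := K) hσ hσσ hσD hσa hD ha
  have hYd : Λ ^ 2 * d - d * Λ ^ 2 = (a • D) a • 1 := by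
    rw [pow_two, ← mul_assoc d, hdΛ, sub_mul, mul_assoc Λ d, hdΛ, mul_sub, hsm, smul_mul_assoc,
      one_mul, mul_one, mul_assoc]
    abel
  have hYe : Λ ^ 2 * e - e * Λ ^ 2 = -(a * a) • 1 + -(a • D) a • d := by
    rw [pow_two, ← mul_assoc e, heΛ, add_mul, mul_assoc Λ e, heΛ, mul_add, hsm, smul_mul_assoc,
      hdΛ, smul_sub, smul_smul, mul_assoc, neg_smul_end, neg_smul_end]
    abel
  let P : AddSubgroup (Module.End K (ℕ → A)) :=
    ((smulAddHom A (Module.End K (ℕ → A))).flip 1).range ⊔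
      ((smulAddHom A (Module.End K (ℕ → A))).flip d).range
  have hmem : ∀ f g : A, f • 1 + g • d ∈ P := fun f g =>
    AddSubgroup.add_mem_sup ⟨f, rfl⟩ ⟨g, rfl⟩
  have hP := pow_char_commutator_mem (K := K) hp P (Y := Λ ^ 2) (Z := e)
    (hYe ▸ hmem _ _) (by
      intro X hX
      obtain ⟨_, ⟨f, rfl⟩, _, ⟨g, rfl⟩, rfl⟩ := AddSubgroup.mem_sup.1 hX
      simp only [AddMonoidHom.flip_apply, smulAddHom_apply]
      rw [mul_add, hsq, hsq, eq_add_of_sub_eq hYd]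
      convert hmem (((a • D) ^ 2) f + g * (a • D) a) (((a • D) ^ 2) g) using 1
      simp only [add_mul, smul_mul_assoc, mul_one, one_mul, smul_add, smul_smul, add_smul]
      abel)
  obtain ⟨_, ⟨f, rfl⟩, _, ⟨g, rfl⟩, hfg⟩ := AddSubgroup.mem_sup.1 hP
  -- Both sides are applied to the sequence of the constant `1`, which `d` and `e` annihilate.
  obtain ⟨j, rfl⟩ : ∃ j, k = j + 3 := ⟨k - 3, by omega⟩
  have hd0 : d (Pi.single 0 (1 : A)) = 0 := by ext i; simp [hd, oddCoeffDeriv_apply]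
  have he0 : e (Pi.single 0 (1 : A)) = 0 := by ext i; simp [he, sqCoeffDeriv_apply]
  have := congrFun (LinearMap.congr_fun hfg (Pi.single 0 1)) (j + 1)
  simp only [LinearMap.add_apply, LinearMap.sub_apply, Module.End.mul_apply, he0] at this
  simp [-nsmul_eq_mul, hd0, ← pow_mul] at this
  exact eq_zero_of_nsmul_eq_zero_of_lt_char (K := K) (by omega : 0 < (j + 1) / 2 + 1) (by omega)
    (by simpa [-nsmul_eq_mul, powCoeff, he, sqCoeffDeriv_apply] using this)

end OddOperator

/-! ### The coefficient of `T ^ 2` in `(a T) ^ (2 p)` -/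

section QuadraticCoefficient

variable {K : Type*} [Field K] {A : Type*} [Ring A] [Algebra K A]

/-- The induction step for the Leibniz expansion of `E ^ m (x * x)`. -/
theorem map_sum_choose_mul_iterate {E : Module.End K A}
    (hE : ∀ f g, E (f * g) = E f * g + f * E g) (x : A) (m : ℕ) :
    E (∑ j ∈ Finset.range (m + 1), m.choose j • ((E ^ j) x * (E ^ (m - j)) x)) =
      ∑ j ∈ Finset.range (m + 2), (m + 1).choose j • ((E ^ j) x * (E ^ (m + 1 - j)) x) := by
  have h1 : ∀ j ∈ Finset.range (m + 1), E (m.choose j • ((E ^ j) x * (E ^ (m - j)) x)) =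
      m.choose j • ((E ^ (j + 1)) x * (E ^ (m + 1 - (j + 1))) x)
        + m.choose j • ((E ^ j) x * (E ^ (m + 1 - j)) x) := by
    intro j hj
    have h2 : m + 1 - j = m - j + 1 := by rw [Finset.mem_range] at hj; omega
    rw [map_nsmul, hE, smul_add, h2, Nat.add_sub_add_right, pow_succ', pow_succ']
    rfl
  have h3 := Finset.sum_range_succ'
    (fun j => m.choose j • ((E ^ j) x * (E ^ (m + 1 - j)) x)) (m + 1)
  rw [Finset.sum_range_succ] at h3
  rw [map_sum, Finset.sum_congr rfl h1, Finset.sum_add_distrib, Finset.sum_range_succ' _ (m + 1)]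
  simp only [Nat.choose_succ_succ', add_smul, Finset.sum_add_distrib, Nat.choose_zero_right,
    Nat.choose_succ_self, zero_smul, add_zero] at h3 ⊢
  rw [h3, add_assoc]

/-- The induction step for the sum over `i < m` of `E ^ (m - 1 - i) (y * E ^ i y)`, whose
coefficients are added up by the hockey-stick identity. -/
theorem map_sum_choose_succ_mul_iterate {E : Module.End K A}
    (hE : ∀ f g, E (f * g) = E f * g + f * E g) (y : A) (m : ℕ) :
    E (∑ j ∈ Finset.range m, m.choose (j + 1) • ((E ^ j) y * (E ^ (m - 1 - j)) y))
        + y * (E ^ m) y =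
      ∑ j ∈ Finset.range (m + 1), (m + 1).choose (j + 1) • ((E ^ j) y * (E ^ (m - j)) y) := by
  have h1 : ∀ j ∈ Finset.range m, E (m.choose (j + 1) • ((E ^ j) y * (E ^ (m - 1 - j)) y)) =
      m.choose (j + 1) • ((E ^ (j + 1)) y * (E ^ (m - (j + 1))) y)
        + m.choose (j + 1) • ((E ^ j) y * (E ^ (m - j)) y) := by
    intro j hj
    rw [Finset.mem_range] at hj
    have h2 : m - j = m - 1 - j + 1 := by omega
    have h3 : m - (j + 1) = m - 1 - j := by omega
    rw [map_nsmul, hE, smul_add, h2, h3, pow_succ', pow_succ']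
    rfl
  rw [map_sum, Finset.sum_congr rfl h1, Finset.sum_add_distrib]
  simp only [Nat.choose_succ_succ' m, add_smul, Finset.sum_add_distrib]
  rw [Finset.sum_range_succ', Finset.sum_range_succ _ m]
  simp
  abel

variable {a : A} {σ D : Module.End K A}

theorem map_smul_pow_apply (hσ : ∀ f g, σ (f * g) = σ f * σ g)
    (hσD : ∀ f, σ (D f) = -D (σ f)) (hσa : σ a = a) (n : ℕ) :
    σ (((a • D) ^ n) a) = (-1 : ℤ) ^ n • ((a • D) ^ n) a := by
  induction n with
  | zero => simpa using hσa
  | succ n ih =>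
    rw [pow_succ' (a • D)]
    simp [-zsmul_eq_mul, hσ, hσa, hσD, ih, pow_succ]

/-- Raising the exponent by `2` applies the even derivation `δ ^ 2`, with `δ = a D`, to the
coefficient of `T ^ 2` and subtracts the product of the odd elements `δ a` and
`δ ^ (2 m + 1) a`.  The first sum starts from `a ^ 2`, the second one collects these products. -/
theorem powCoeff_even_two (hσ : ∀ f g, σ (f * g) = σ f * σ g) (hσ1 : σ 1 = 1)
    (hσD : ∀ f, σ (D f) = -D (σ f)) (hσa : σ a = a) (hσσ : ∀ f, σ (σ f) = f)
    (hD : ∀ f g, D (f * g) = D f * g + σ f * D g) (ha : ∀ f, a * f = f * a) (m : ℕ) :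
    powCoeff a σ D (2 * (m + 1)) 2 =
      ∑ j ∈ Finset.range (m + 1),
          m.choose j • (((a • D) ^ (2 * j)) a * ((a • D) ^ (2 * (m - j))) a)
        - ∑ j ∈ Finset.range m, m.choose (j + 1) •
          (((a • D) ^ (2 * j + 1)) a * ((a • D) ^ (2 * (m - 1 - j) + 1)) a) := by
  have hD1 : D 1 = 0 := by simpa [hσ1] using hD 1 1
  have hδ : ∀ f g, (a • D) (f * g) = (a • D) f * g + σ f * (a • D) g := by
    intro f g
    simp only [LinearMap.smul_apply, smul_eq_mul, hD, mul_add, mul_assoc]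
    rw [← mul_assoc a (σ f), ha (σ f), mul_assoc]
  have hσδ : ∀ f, σ ((a • D) f) = -(a • D) (σ f) := fun f => by simp [hσ, hσa, hσD]
  have hE : ∀ f g, ((a • D) ^ 2) (f * g) = ((a • D) ^ 2) f * g + f * ((a • D) ^ 2) g := by
    intro f g
    rw [pow_two, Module.End.mul_apply, hδ, map_add, hδ, hδ, hσδ, hσσ]
    simp only [Module.End.mul_apply, neg_mul]
    abel
  have hc1 : ∀ n, powCoeff a σ D (n + 1) 2 =
      (a • D) (powCoeff a σ D n 2) + a * σ (powCoeff a σ D n 1) := fun n => by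
    rw [powCoeff_succ, leftMulStep_apply_succ]; rfl
  simp only [pow_succ (a • D) (2 * _), pow_mul, Module.End.mul_apply]
  induction m with
  | zero =>
    have h1 := powCoeff_succ_one (a := a) (σ := σ) (D := D) hσ1 hD1 0
    have h2 : powCoeff a σ D 1 2 = 0 := powCoeff_eq_zero_of_lt (by omega)
    rw [show 2 * (0 + 1) = 1 + 1 from rfl, hc1, h1, h2]
    simp [hσa]
  | succ m ih =>
    have h1 : powCoeff a σ D (2 * (m + 1 + 1)) 2 = ((a • D) ^ 2) (powCoeff a σ D (2 * (m + 1)) 2)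
        - (a • D) a * (((a • D) ^ 2) ^ m) ((a • D) a) := by
      rw [show 2 * (m + 1 + 1) = 2 * (m + 1) + 1 + 1 from rfl, hc1, hc1,
        powCoeff_succ_one hσ1 hD1, show 2 * (m + 1) = 2 * m + 1 + 1 from rfl,
        powCoeff_succ_one hσ1 hD1, map_smul_pow_apply hσ hσD hσa,
        map_smul_pow_apply hσ hσD hσa, (Even.neg_one_pow ⟨m + 1, by omega⟩ :
          (-1 : ℤ) ^ (2 * m + 1 + 1) = 1), (Odd.neg_one_pow ⟨m, rfl⟩ : (-1 : ℤ) ^ (2 * m + 1) = -1),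
        one_smul, neg_one_smul, mul_neg, map_add, map_neg, hδ, hσa, pow_succ' _ (2 * m + 1),
        pow_two, ← pow_two, ← pow_mul, ← Module.End.mul_apply _ (a • D) a, ← pow_succ]
      simp only [Module.End.mul_apply, pow_two]
      abel
    have h2 := map_sum_choose_mul_iterate hE a m
    have h3 := map_sum_choose_succ_mul_iterate hE ((a • D) a) m
    rw [h1, ih, map_sub, h2, Nat.add_sub_cancel, ← h3]
    abel

/-- The congruence `(p - 1).choose j ≡ (-1) ^ j` modulo `p`. -/
theorem choose_pred_char_smul {p : ℕ} (hp : p.Prime) [CharP K p] (x : A) {j : ℕ} (hj : j < p) :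
    (p - 1).choose j • x = (-1 : ℤ) ^ j • x := by
  induction j with
  | zero => simp
  | succ j ih =>
    have h1 : (p - 1).choose j + (p - 1).choose (j + 1) = p.choose (j + 1) := by
      rw [← Nat.choose_succ_succ', Nat.sub_add_cancel hp.one_le]
    have h2 : p.choose (j + 1) • x = 0 := by
      rw [← Nat.cast_smul_eq_nsmul K,
        (CharP.cast_eq_zero_iff K p _).2 (hp.dvd_choose_self (by omega) hj), zero_smul]
    rw [← h1, add_smul, ih (by omega)] at h2
    rw [pow_succ, mul_neg_one, neg_smul]
    exact (neg_eq_of_add_eq_zero_right h2).symm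

theorem sum_range_two_mul_of_symm {G : Type*} [AddCommGroup G] (q : ℕ) (f : ℕ → G)
    (h : ∀ j < q, f (2 * q - 1 - j) = f j) :
    ∑ j ∈ Finset.range (2 * q), f j = ∑ j ∈ Finset.range q, (2 : ℤ) • f j := by
  induction q generalizing f with
  | zero => simp
  | succ q ih =>
    have h0 := h 0 (by omega)
    rw [show 2 * (q + 1) = 2 * q + 1 + 1 from rfl, Finset.sum_range_succ, Finset.sum_range_succ',
      ih, Finset.sum_range_succ', show f (2 * q + 1) = f 0 from h0, two_smul, add_assoc]
    intro j hj
    rw [← h (j + 1) (by omega)]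
    congr 1
    omega

theorem sum_range_two_mul_add_one_of_symm {G : Type*} [AddCommGroup G] (q : ℕ) (f : ℕ → G)
    (h : ∀ j < q, f (2 * q - j) = f j) :
    ∑ j ∈ Finset.range (2 * q + 1), f j = ∑ j ∈ Finset.range q, (2 : ℤ) • f j + f q := by
  induction q generalizing f with
  | zero => simp
  | succ q ih =>
    have h0 := h 0 (by omega)
    rw [show 2 * (q + 1) + 1 = 2 * q + 1 + 1 + 1 from rfl, Finset.sum_range_succ,
      Finset.sum_range_succ', ih, Finset.sum_range_succ' _ q,
      show f (2 * q + 1 + 1) = f 0 from h0, two_smul]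
    · abel
    · intro j hj
      rw [← h (j + 1) (by omega)]
      congr 1
      omega

theorem sum_range_two_mul_eq {G : Type*} [AddCommGroup G] (q : ℕ) (f : ℕ → G) :
    ∑ j ∈ Finset.range (2 * q), f j = ∑ j ∈ Finset.range q, (f (2 * j) + f (2 * j + 1)) := by
  induction q with
  | zero => simp
  | succ q ih =>
    rw [show 2 * (q + 1) = 2 * q + 1 + 1 from rfl, Finset.sum_range_succ, Finset.sum_range_succ,
      ih, Finset.sum_range_succ, add_assoc]

/-- The terms `i` and `2 p - 2 - i` agree: even factors commute, odd ones anticommute, and the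
signs compensate.  This accounts for the factors `2` in `hochschildCoeff`. -/
theorem sum_hochschildCoeff {q : ℕ} (s : ℕ → A)
    (he : ∀ i j, s (2 * i) * s (2 * j) = s (2 * j) * s (2 * i))
    (ho : ∀ i j, s (2 * i + 1) * s (2 * j + 1) = -(s (2 * j + 1) * s (2 * i + 1))) :
    ∑ i ∈ Finset.range (2 * q + 1),
        hochschildCoeff (2 * q + 1) i • (s i * s (2 * (2 * q + 1) - 2 - i)) =
      ∑ j ∈ Finset.range (2 * q + 1), (-1 : ℤ) ^ j • (s (2 * j) * s (2 * (2 * q - j)))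
        + ∑ j ∈ Finset.range (2 * q),
          (-1 : ℤ) ^ j • (s (2 * j + 1) * s (2 * (2 * q - 1 - j) + 1)) := by
  rw [Finset.sum_range_succ, sum_range_two_mul_eq, sum_range_two_mul_add_one_of_symm q,
    sum_range_two_mul_of_symm q, add_right_comm, ← Finset.sum_add_distrib]
  · congr 1
    · refine Finset.sum_congr rfl fun j hj => ?_
      rw [Finset.mem_range] at hj
      have h1 : hochschildCoeff (2 * q + 1) (2 * j) = 2 * (-1) ^ j := by
        rw [hochschildCoeff, if_neg (by omega), if_pos (by simp)]
        congr 2; omega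
      have h2 : hochschildCoeff (2 * q + 1) (2 * j + 1) = 2 * (-1) ^ j := by
        rw [hochschildCoeff, if_neg (by omega), if_neg (by simp)]
        congr 2; omega
      rw [h1, h2, mul_smul, mul_smul,
        show 2 * (2 * q + 1) - 2 - 2 * j = 2 * (2 * q - j) by omega,
        show 2 * (2 * q + 1) - 2 - (2 * j + 1) = 2 * (2 * q - 1 - j) + 1 by omega]
    · rw [hochschildCoeff, if_pos (by omega)]
      congr 2
      · omega
      · congr 2; omega
  · intro j hj
    rw [ho, show 2 * q - 1 - (2 * q - 1 - j) = j by omega]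
    have h1 : (-1 : ℤ) ^ (2 * q - 1 - j) = -(-1) ^ j := by
      rw [← neg_one_mul ((-1 : ℤ) ^ j), ← pow_succ']
      refine neg_one_pow_congr ?_
      rw [show 2 * q - 1 - j = 2 * q - (j + 1) by omega, Nat.even_sub (by omega)]
      simp
    rw [h1, neg_smul, smul_neg, neg_neg]
  · intro j hj
    rw [he, show 2 * q - (2 * q - j) = j by omega]
    congr 1
    exact neg_one_pow_congr (by rw [Nat.even_sub (by omega)]; simp)

end QuadraticCoefficient

/-! ### Powers of scaled operators -/

section SmulPow

variable {K : Type*} [Field K] {A : Type*} [Ring A] [Algebra K A] {M : Type*} [AddCommGroup M]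
  [Module K M] [Module A M] [IsScalarTower K A M]
  {a : A} {σ D : Module.End K A} {T : Module.End K M}

/-- The analogue of Hochschild's lemma for an odd operator `T`, scaled by an even element `a`:
`σ` is the parity involution of `A`. -/
theorem smul_pow_two_mul_char_of_twisted_leibniz {p : ℕ} (hp : p.Prime) [CharP K p] (hp3 : 3 ≤ p)
    (hσ : ∀ f g, σ (f * g) = σ f * σ g) (hσ1 : σ 1 = 1) (hσσ : ∀ f, σ (σ f) = f)
    (hσD : ∀ f, σ (D f) = -D (σ f)) (hσa : σ a = a)
    (hD : ∀ f g, D (f * g) = D f * g + σ f * D g)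
    (ha : ∀ f, a * f = f * a)
    (hodd : ∀ f g, σ f = -f → σ g = -g → f * g = -(g * f))
    (heven : ∀ f g, σ f = f → σ g = g → f * g = g * f)
    (hT : ∀ (f : A) (m : M), T (f • m) = σ f • T m + D f • m) :
    (a • T) ^ (2 * p) = a ^ (2 * p) • T ^ (2 * p) + ((a • D) ^ (2 * p - 1)) a • T
      + (∑ i ∈ Finset.range p, hochschildCoeff p i •
          (((a • D) ^ i) a * ((a • D) ^ (2 * p - 2 - i)) a)) • T ^ 2 := by
  have hD1 : D 1 = 0 := by simpa [hσ1] using hD 1 1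
  have hpar := map_smul_pow_apply (D := D) hσ hσD hσa
  have hpar0 : ∀ i, σ (((a • D) ^ (2 * i)) a) = ((a • D) ^ (2 * i)) a := fun i => by
    rw [hpar, (even_two_mul i).neg_one_pow, one_smul]
  have hpar1 : ∀ i, σ (((a • D) ^ (2 * i + 1)) a) = -((a • D) ^ (2 * i + 1)) a := fun i => by
    rw [hpar, (odd_two_mul_add_one i).neg_one_pow, neg_one_smul]
  obtain ⟨q, rfl⟩ : ∃ q, p = 2 * q + 1 := hp.odd_of_ne_two (by omega)
  have hquad : powCoeff a σ D (2 * (2 * q + 1)) 2 =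
      ∑ i ∈ Finset.range (2 * q + 1), hochschildCoeff (2 * q + 1) i •
          (((a • D) ^ i) a * ((a • D) ^ (2 * (2 * q + 1) - 2 - i)) a) := by
    rw [powCoeff_even_two hσ hσ1 hσD hσa hσσ hD ha,
      sum_hochschildCoeff (fun i => ((a • D) ^ i) a)
        (fun i j => heven _ _ (hpar0 i) (hpar0 j)) (fun i j => hodd _ _ (hpar1 i) (hpar1 j)),
      sub_eq_add_neg, ← Finset.sum_neg_distrib]
    congr 1
    · refine Finset.sum_congr rfl fun j hj => ?_
      exact choose_pred_char_smul (K := K) hp _ (Finset.mem_range.1 hj)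
    · refine Finset.sum_congr rfl fun j hj => ?_
      have := choose_pred_char_smul (K := K) hp
        (((a • D) ^ (2 * j + 1)) a * ((a • D) ^ (2 * (2 * q - 1 - j) + 1)) a)
        (show j + 1 < 2 * q + 1 by have := Finset.mem_range.1 hj; omega)
      rw [Nat.add_sub_cancel] at this
      rw [this, pow_succ, mul_neg_one, neg_smul, neg_neg]
  rw [smul_pow_eq_sum_powCoeff hT, Finset.sum_range_succ, powCoeff_self hσ hσ1 hσa, ← hquad,
    ← Finset.sum_subset (s₁ := {1, 2})]
  · rw [Finset.sum_pair (by norm_num), show powCoeff a σ D (2 * (2 * q + 1)) 1 =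
      ((a • D) ^ (2 * (2 * q + 1) - 1)) a from powCoeff_succ_one hσ1 hD1 (2 * (2 * q) + 1), pow_one]
    abel
  · intro k hk
    simp only [Finset.mem_insert, Finset.mem_singleton] at hk
    rw [Finset.mem_range]
    omega
  · intro k hk hk12
    simp only [Finset.mem_insert, Finset.mem_singleton, not_or] at hk12
    rw [Finset.mem_range] at hk
    rcases Nat.eq_zero_or_pos k with rfl | hk0
    · rw [show powCoeff a σ D (2 * (2 * q + 1)) 0 = 0 from
        powCoeff_succ_zero hD1 (2 * (2 * q) + 1), zero_smul]
    · rw [powCoeff_two_mul_prime_eq_zero hp hσ hσσ hσD hσa hD ha (by omega) hk, zero_smul]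

/-- For odd `a` and even `T` already the cube of `a T` vanishes: `(a T) ^ 2 = a (D a) T`, and the
odd elements `a` and `D a` square to zero. -/
theorem smul_pow_three_eq_zero (hD : D (a * D a) = D a * D a + a * D (D a))
    (ha : a * a = 0) (hDa : D a * D a = 0)
    (hT : ∀ (f : A) (m : M), T (f • m) = f • T m + D f • m) : (a • T) ^ 3 = 0 := by
  ext m
  simp only [pow_succ, pow_zero, one_mul, Module.End.mul_apply, LinearMap.smul_apply, hT,
    smul_add, smul_smul, LinearMap.zero_apply]
  rw [ha, zero_smul, zero_add, hT, hD, hDa]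
  simp [smul_smul, ← mul_assoc, ha]

/-- For odd `a` and odd `T`, the element `D a` is even and `T a = -a T + D a`. -/
theorem smul_pow_succ_of_odd_of_odd (ha : a * a = 0) (hDa : D a * a = a * D a)
    (hT : ∀ m : M, T (a • m) = -(a • T m) + D a • m) (n : ℕ) :
    (a • T) ^ (n + 1) = (a * D a ^ n) • T := by
  induction n with
  | zero => simp
  | succ n ih =>
    rw [pow_succ, ih]
    ext m
    have h : Commute (D a) a := hDa
    have h2 : a * D a ^ n * a = 0 := by rw [mul_assoc, (h.pow_left n).eq, ← mul_assoc, ha, zero_mul]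
    simp [hT, smul_smul, h2, pow_succ, mul_assoc]

end SmulPow

/-! ### Passage to superspaces -/

section Super

variable {K : Type*} [Field K]

theorem exists_even_add_odd {V : Type*} [AddCommGroup V] [Module K V]
    (𝒱 : ZMod 2 → Submodule K V) [DirectSum.Decomposition 𝒱] (v : V) :
    ∃ v₀ ∈ 𝒱 0, ∃ v₁ ∈ 𝒱 1, v₀ + v₁ = v := by
  induction v using DirectSum.Decomposition.inductionOn 𝒱 with
  | zero => exact ⟨0, zero_mem _, 0, zero_mem _, add_zero 0⟩
  | @homogeneous i m =>
    obtain ⟨m, hm⟩ := m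
    fin_cases i
    · exact ⟨m, hm, 0, zero_mem _, add_zero m⟩
    · exact ⟨0, zero_mem _, m, hm, zero_add m⟩
  | add v w hv hw =>
    obtain ⟨v₀, hv₀, v₁, hv₁, rfl⟩ := hv
    obtain ⟨w₀, hw₀, w₁, hw₁, rfl⟩ := hw
    exact ⟨v₀ + w₀, add_mem hv₀ hw₀, v₁ + w₁, add_mem hv₁ hw₁, add_add_add_comm ..⟩

@[simp] theorem koszulSign_zero_left (j : ZMod 2) : koszulSign 0 j = 1 := by simp [koszulSign]

@[simp] theorem koszulSign_zero_right (i : ZMod 2) : koszulSign i 0 = 1 := by simp [koszulSign]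

@[simp] theorem koszulSign_one_one : koszulSign 1 1 = -1 := by simp [koszulSign, ZMod.val_one]

variable {A : Type*} [Ring A] [Algebra K A] {𝒜 : ZMod 2 → Submodule K A}

theorem IsSupercommutative.odd_mul_odd (h : IsSupercommutative 𝒜) {f g : A} (hf : f ∈ 𝒜 1)
    (hg : g ∈ 𝒜 1) : f * g = -(g * f) := by
  simpa using h 1 1 f hf g hg

theorem IsSupercommutative.odd_mul_self (h : IsSupercommutative 𝒜) (h2 : (2 : K) ≠ 0) {f : A}
    (hf : f ∈ 𝒜 1) : f * f = 0 := by
  have := h.odd_mul_odd hf hf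
  rw [eq_neg_iff_add_eq_zero, ← two_smul K, smul_eq_zero] at this
  exact this.resolve_left h2

variable [GradedAlgebra 𝒜]

variable (𝒜) in
/-- The parity involution of a superalgebra: the identity on the even part, minus the identity on
the odd part. -/
def parityInvolution : Module.End K A := GradedAlgebra.proj 𝒜 0 - GradedAlgebra.proj 𝒜 1

theorem parityInvolution_even {f : A} (hf : f ∈ 𝒜 0) : parityInvolution 𝒜 f = f := by
  simp [parityInvolution, GradedAlgebra.proj_apply, DirectSum.decompose_of_mem_same 𝒜 hf,
    DirectSum.decompose_of_mem_ne 𝒜 hf (zero_ne_one' (ZMod 2))]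

theorem parityInvolution_odd {f : A} (hf : f ∈ 𝒜 1) : parityInvolution 𝒜 f = -f := by
  simp [parityInvolution, GradedAlgebra.proj_apply, DirectSum.decompose_of_mem_same 𝒜 hf,
    DirectSum.decompose_of_mem_ne 𝒜 hf (one_ne_zero' (ZMod 2))]

theorem parityInvolution_involutive (f : A) :
    parityInvolution 𝒜 (parityInvolution 𝒜 f) = f := by
  obtain ⟨f₀, h₀, f₁, h₁, rfl⟩ := exists_even_add_odd 𝒜 f
  simp [parityInvolution_even h₀, parityInvolution_odd h₁]

theorem parityInvolution_mul (f g : A) :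
    parityInvolution 𝒜 (f * g) = parityInvolution 𝒜 f * parityInvolution 𝒜 g := by
  obtain ⟨f₀, hf₀, f₁, hf₁, rfl⟩ := exists_even_add_odd 𝒜 f
  obtain ⟨g₀, hg₀, g₁, hg₁, rfl⟩ := exists_even_add_odd 𝒜 g
  have h00 : f₀ * g₀ ∈ 𝒜 0 := by simpa using SetLike.mul_mem_graded hf₀ hg₀
  have h01 : f₀ * g₁ ∈ 𝒜 1 := by simpa using SetLike.mul_mem_graded hf₀ hg₁
  have h10 : f₁ * g₀ ∈ 𝒜 1 := by simpa using SetLike.mul_mem_graded hf₁ hg₀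
  have h11 : f₁ * g₁ ∈ 𝒜 0 := SetLike.mul_mem_graded hf₁ hg₁
  simp only [add_mul, mul_add, map_add, parityInvolution_even hf₀, parityInvolution_even hg₀,
    parityInvolution_odd hf₁, parityInvolution_odd hg₁, parityInvolution_even h00,
    parityInvolution_even h11, parityInvolution_odd h01, parityInvolution_odd h10, neg_mul,
    mul_neg]
  abel

/-- Outside characteristic `2` the parity involution detects the even part. -/
theorem mem_even_of_parityInvolution_eq (h2 : (2 : K) ≠ 0) {f : A}
    (hf : parityInvolution 𝒜 f = f) : f ∈ 𝒜 0 := by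
  obtain ⟨f₀, h₀, f₁, h₁, rfl⟩ := exists_even_add_odd 𝒜 f
  rw [map_add, parityInvolution_even h₀, parityInvolution_odd h₁, add_right_inj,
    neg_eq_iff_add_eq_zero, ← two_smul K, smul_eq_zero] at hf
  simpa [hf.resolve_left h2] using h₀

/-- Outside characteristic `2` the parity involution detects the odd part. -/
theorem mem_odd_of_parityInvolution_eq_neg (h2 : (2 : K) ≠ 0) {f : A}
    (hf : parityInvolution 𝒜 f = -f) : f ∈ 𝒜 1 := by
  obtain ⟨f₀, h₀, f₁, h₁, rfl⟩ := exists_even_add_odd 𝒜 f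
  rw [map_add, parityInvolution_even h₀, parityInvolution_odd h₁, neg_add, add_left_inj,
    eq_neg_iff_add_eq_zero, ← two_smul K, smul_eq_zero] at hf
  simpa [hf.resolve_left h2] using h₁

theorem IsSupercommutative.even_mul (h : IsSupercommutative 𝒜) {a : A} (ha : a ∈ 𝒜 0) (f : A) :
    a * f = f * a := by
  obtain ⟨f₀, h₀, f₁, h₁, rfl⟩ := exists_even_add_odd 𝒜 f
  have e₀ : a * f₀ = f₀ * a := by simpa using h 0 0 a ha f₀ h₀
  have e₁ : a * f₁ = f₁ * a := by simpa using h 0 1 a ha f₁ h₁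
  rw [mul_add, add_mul, e₀, e₁]

theorem IsSuperDerivation.leibniz_even {D : Module.End K A} (h : IsSuperDerivation 𝒜 0 D)
    (f g : A) : D (f * g) = D f * g + f * D g := by
  obtain ⟨f₀, h₀, f₁, h₁, rfl⟩ := exists_even_add_odd 𝒜 f
  have e₀ : D (f₀ * g) = D f₀ * g + f₀ * D g := by simpa using h.2 0 f₀ h₀ g
  have e₁ : D (f₁ * g) = D f₁ * g + f₁ * D g := by simpa using h.2 1 f₁ h₁ g
  simp only [add_mul, map_add, e₀, e₁]
  abel

theorem IsSuperDerivation.leibniz_odd {D : Module.End K A} (h : IsSuperDerivation 𝒜 1 D)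
    (f g : A) : D (f * g) = D f * g + parityInvolution 𝒜 f * D g := by
  obtain ⟨f₀, h₀, f₁, h₁, rfl⟩ := exists_even_add_odd 𝒜 f
  have e₀ : D (f₀ * g) = D f₀ * g + f₀ * D g := by simpa using h.2 0 f₀ h₀ g
  have e₁ : D (f₁ * g) = D f₁ * g - f₁ * D g := by simpa [sub_eq_add_neg] using h.2 1 f₁ h₁ g
  simp only [add_mul, map_add, e₀, e₁, parityInvolution_even h₀, parityInvolution_odd h₁]
  noncomm_ring

theorem IsSuperDerivation.parityInvolution_apply {D : Module.End K A}
    (h : IsSuperDerivation 𝒜 1 D) (f : A) :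
    parityInvolution 𝒜 (D f) = -D (parityInvolution 𝒜 f) := by
  obtain ⟨f₀, h₀, f₁, h₁, rfl⟩ := exists_even_add_odd 𝒜 f
  have e₀ : D f₀ ∈ 𝒜 1 := by simpa using h.1 0 f₀ h₀
  have e₁ : D f₁ ∈ 𝒜 0 := h.1 1 f₁ h₁
  simp [parityInvolution_even h₀, parityInvolution_odd h₁, parityInvolution_even e₁,
    parityInvolution_odd e₀, add_comm]

variable {L : Type*} [AddCommGroup L] [Module K L] [Module A L] [IsScalarTower K A L]
  {𝓛 : ZMod 2 → Submodule K L} {R : LieRinehartSuperalgebra 𝒜 𝓛}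
  {M : Type*} [AddCommGroup M] [Module K M] [Module A M] [IsScalarTower K A M]
  {ℳ : ZMod 2 → Submodule K M}

theorem LieRinehartModule.act_even_smul (φ : LieRinehartModule R ℳ) {x : L} (hx : x ∈ 𝓛 0)
    (f : A) (m : M) : φ.act x (f • m) = f • φ.act x m + R.anchor x f • m := by
  obtain ⟨f₀, h₀, f₁, h₁, rfl⟩ := exists_even_add_odd 𝒜 f
  have e₀ := φ.act_leibniz 0 0 x hx f₀ h₀ m
  have e₁ := φ.act_leibniz 0 1 x hx f₁ h₁ m
  rw [koszulSign_zero_left, one_smul] at e₀ e₁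
  simp only [add_smul, map_add, e₀, e₁]
  abel

theorem LieRinehartModule.act_odd_smul (φ : LieRinehartModule R ℳ) {x : L} (hx : x ∈ 𝓛 1)
    (f : A) (m : M) :
    φ.act x (f • m) = parityInvolution 𝒜 f • φ.act x m + R.anchor x f • m := by
  obtain ⟨f₀, h₀, f₁, h₁, rfl⟩ := exists_even_add_odd 𝒜 f
  have e₀ := φ.act_leibniz 1 0 x hx f₀ h₀ m
  have e₁ := φ.act_leibniz 1 1 x hx f₁ h₁ m
  rw [koszulSign_zero_right, one_smul] at e₀
  rw [koszulSign_one_one, neg_one_smul] at e₁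
  simp only [add_smul, map_add, e₀, e₁, parityInvolution_even h₀, parityInvolution_odd h₁,
    neg_smul]
  abel

end Super

theorem theorem3p1 {K : Type*} [Field K] (p : ℕ) [CharP K p] (hp : 3 ≤ p)
    {A : Type*} [Ring A] [Algebra K A] (𝒜 : ZMod 2 → Submodule K A) [GradedAlgebra 𝒜]
    {L : Type*} [AddCommGroup L] [Module K L] [Module A L] [IsScalarTower K A L]
    (𝓛 : ZMod 2 → Submodule K L) [DirectSum.Decomposition 𝓛] [SetLike.GradedSMul 𝒜 𝓛]
    (R : LieRinehartSuperalgebra 𝒜 𝓛)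
    {M : Type*} [AddCommGroup M] [Module K M] [Module A M] [IsScalarTower K A M]
    (ℳ : ZMod 2 → Submodule K M) [DirectSum.Decomposition ℳ] [SetLike.GradedSMul 𝒜 ℳ]
    (φ : LieRinehartModule R ℳ) :
    (∀ a ∈ 𝒜 0, ∀ x ∈ 𝓛 0,
      φ.act (a • x) ^ p =
        a ^ p • φ.act x ^ p + (R.anchor (a • x) ^ (p - 1)) a • φ.act x) ∧
    (∀ a ∈ 𝒜 0, ∀ x ∈ 𝓛 1,
      φ.act (a • x) ^ (2 * p) =
        a ^ (2 * p) • φ.act x ^ (2 * p)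
          + (R.anchor (a • x) ^ (2 * p - 1)) a • φ.act x
          + (∑ i ∈ Finset.range p, hochschildCoeff p i •
              ((R.anchor (a • x) ^ i) a * (R.anchor (a • x) ^ (2 * p - 2 - i)) a)) •
            φ.act x ^ 2) ∧
    (∀ a ∈ 𝒜 1, ∀ x ∈ 𝓛 0, φ.act (a • x) ^ (2 * p) = 0) ∧
    (∀ a ∈ 𝒜 1, ∀ x ∈ 𝓛 1,
      φ.act (a • x) ^ p = (a * (R.anchor x a) ^ (p - 1)) • φ.act x) := by
  have hprime : p.Prime := (CharP.char_is_prime_or_zero K p).resolve_right (by omega)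
  have h2 : (2 : K) ≠ 0 := fun h => by
    have := Nat.le_of_dvd two_pos ((CharP.cast_eq_zero_iff K p 2).1 (by exact_mod_cast h))
    omega
  refine ⟨fun a ha x hx => ?_, fun a ha x hx => ?_, fun a ha x hx => ?_, fun a ha x hx => ?_⟩
  · rw [φ.act_smul, R.anchor_smul]
    exact smul_pow_char_of_leibniz hprime (R.anchor_superDerivation 0 x hx).leibniz_even
      (R.supercomm.even_mul ha) (φ.act_even_smul hx)
  · rw [φ.act_smul, R.anchor_smul]
    have hx' := R.anchor_superDerivation 1 x hx
    exact smul_pow_two_mul_char_of_twisted_leibniz hprime hp parityInvolution_mul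
      (parityInvolution_even SetLike.GradedOne.one_mem) parityInvolution_involutive
      hx'.parityInvolution_apply (parityInvolution_even ha) hx'.leibniz_odd
      (R.supercomm.even_mul ha)
      (fun f g hf hg => R.supercomm.odd_mul_odd (mem_odd_of_parityInvolution_eq_neg h2 hf)
        (mem_odd_of_parityInvolution_eq_neg h2 hg))
      (fun f g hf _ => R.supercomm.even_mul (mem_even_of_parityInvolution_eq h2 hf) g)
      (φ.act_odd_smul hx)
  · have hx' := R.anchor_superDerivation 0 x hx
    have hDa : R.anchor x a ∈ 𝒜 1 := by simpa using hx'.1 1 a ha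
    have h3 := smul_pow_three_eq_zero (hx'.leibniz_even a _) (R.supercomm.odd_mul_self h2 ha)
      (R.supercomm.odd_mul_self h2 hDa) (φ.act_even_smul hx)
    rw [φ.act_smul]
    exact pow_eq_zero_of_le (by omega) h3
  · have hDa : R.anchor x a ∈ 𝒜 0 := (R.anchor_superDerivation 1 x hx).1 1 a ha
    have h := smul_pow_succ_of_odd_of_odd (D := R.anchor x) (T := φ.act x)
      (R.supercomm.odd_mul_self h2 ha) (R.supercomm.even_mul hDa a)
      (fun m => by rw [φ.act_odd_smul hx, parityInvolution_odd ha, neg_smul]) (p - 1)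
    rwa [Nat.sub_add_cancel hprime.one_le, ← φ.act_smul] at h
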